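/- For an additive category $\mathcal C$ let $\operatorname{mod}\mathcal C$ denote the category of finitely presented functors, that is, of the additive functors $F\colon\mathcal C^{\mathrm{op}}\to\mathrm{Ab}$ that admit an exact presentation $\operatorname{Hom}(-,X)\to\operatorname{Hom}(-,Y)\to F\to 0$ with $X,Y\in\mathcal C$. Every additive functor $g\colon\mathcal C\to\mathcal D$ into an additive category with cokernels extends along the Yoneda functor $\mathcal C\to\operatorname{mod}\mathcal C$, $X\mapsto\operatorname{Hom}(-,X)$, to a right exact functor $\operatorname{mod}\mathcal C\to\mathcal D$, unique up to isomorphism; it sends $\operatorname{Coker}\operatorname{Hom}(-,\phi)$ to $\operatorname{Coker} g(\phi)$. Let $\mathcal A$ be an abelian category. The Yoneda functor $\mathcal A\to\operatorname{mod}\mathcal A$ has a left adjoint (the right exact extension $\operatorname{mod}\mathcal A\to\mathcal A$ of the identity), and $\operatorname{eff}\mathcal A\subseteq\operatorname{mod}\mathcal A$ denotes the full subcategory of effaceable functors, i.e. those sent to zero by this left adjoint. Let $i\colon\mathcal C\to\mathcal A$ be the inclusion of a full additive subcategory, let $i^*\colon\operatorname{mod}\mathcal C\to\operatorname{mod}\mathcal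 A$ be the right exact functor extending $\mathcal C\xrightarrow{i}\mathcal A\to\operatorname{mod}\mathcal A$, and let $\operatorname{eff}(\mathcal A,\mathcal C)\subseteq\operatorname{mod}\mathcal C$ be the full subcategory of those $F$ with $i^*F\in\operatorname{eff}\mathcal A$. One says that $\mathcal C$ generates $\mathcal A$ if every object $X\in\mathcal A$ admits an epimorphism $C\to X$ with $C\in\mathcal C$. **Proposition (relative Auslander formula).** Let $\mathcal A$ be an abelian category and $\mathcal C\subseteq\mathcal A$ a full additive subcategory such that $\operatorname{mod}\mathcal C$ is abelian. Then $\mathcal C$ generates $\mathcal A$ if and only if the right exact functor $E\colon\operatorname{mod}\mathcal C\to\mathcal A$ extending the inclusion $\mathcal C\to\mathcal A$ is exact, $\operatorname{eff}(\mathcal A,\mathcal C)$ is a Serre subcategory of $\operatorname{mod}\mathcal C$, and $E$ induces an equivalence $$(\operatorname{mod}\mathcal C)/\operatorname{eff}(\mathcal A,\mathcal C)\xrightarrow{\ \sim\ }\mathcal A$$ from the Serre quotient, i.e. the localization of $\operatorname{mod}\mathcal C$ at the morphisms whose kernel and cokernel lie in $\operatorname{eff}(\mathcal A,\mathcal C)$.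 -/

import Mathlib

open CategoryTheory CategoryTheory.Limits Opposite

universe v v' u u'

noncomputable section

namespace CoherentFunctor

section Basic

variable {C : Type u} [Category.{v} C] [Preadditive C]

/-- A presentation `Hom(-, X) ⟶ Hom(-, Y) ⟶ F ⟶ 0` (exact in the category of functors) of a
functor `F : Cᵒᵖ ⥤ Ab`. -/
structure Presentation (F : Cᵒᵖ ⥤ AddCommGrpCat.{v}) where
  X : C
  Y : C
  /-- the presenting morphism -/
  f : X ⟶ Y
  p : preadditiveYoneda.obj Y ⟶ F
  w : preadditiveYoneda.map f ≫ p = 0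
  exact : (ShortComplex.mk (preadditiveYoneda.map f) p w).Exact
  epi : Epi p

variable (C) in
/-- The finitely presented (or coherent) functors: the additive functors `Cᵒᵖ ⥤ Ab` which admit
a presentation by representable functors. -/
def isFinPres : ObjectProperty (Cᵒᵖ ⥤ AddCommGrpCat.{v}) :=
  fun F => F.Additive ∧ Nonempty (Presentation F)

variable (C) in
/-- The category `mod C` of finitely presented functors `Cᵒᵖ ⥤ Ab`, a full subcategory of the
category of all functors. -/
def FPMod : Type (max u (v + 1)) := (isFinPres C).FullSubcategory

instance : Category.{max u v} (FPMod C) :=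
  inferInstanceAs (Category (isFinPres C).FullSubcategory)

variable (C) in
/-- The inclusion of `mod C` in the category of functors `Cᵒᵖ ⥤ Ab`. -/
def FPMod.ι : FPMod C ⥤ (Cᵒᵖ ⥤ AddCommGrpCat.{v}) := (isFinPres C).ι

instance : (FPMod.ι C).Full := inferInstanceAs (isFinPres C).ι.Full
instance : (FPMod.ι C).Faithful := inferInstanceAs (isFinPres C).ι.Faithful

/-- The category `mod C` as the target of functors. -/
def FPMod.lift {B : Type u'} [Category.{v'} B] (T : B ⥤ (Cᵒᵖ ⥤ AddCommGrpCat.{v}))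
    (hT : ∀ b, isFinPres C (T.obj b)) : B ⥤ FPMod C :=
  (isFinPres C).lift T hT

/-- A chosen presentation of an object of `mod C`. -/
def FPMod.pres (F : FPMod C) : Presentation ((FPMod.ι C).obj F) := F.property.2.some

instance : (preadditiveYoneda (C := C)).Additive where
  map_add {X Y f g} := by
    ext Z (x : Z.unop ⟶ X)
    exact Preadditive.comp_add _ _ _ x f g

namespace Presentation

variable {F : Cᵒᵖ ⥤ AddCommGrpCat.{v}} (P : Presentation F)

lemma exists_lift {Z : C} (q : preadditiveYoneda.obj Z ⟶ F) :
    ∃ b : Z ⟶ P.Y, preadditiveYoneda.map b ≫ P.p = q := by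
  have := P.epi
  have h : Function.Surjective (P.p.app (op Z)) :=
    (AddCommGrpCat.epi_iff_surjective _).1 inferInstance
  obtain ⟨b, hb⟩ := h (q.app (op Z) (𝟙 Z))
  let b' : Z ⟶ P.Y := b
  refine ⟨b', ?_⟩
  ext W (x : W.unop ⟶ Z)
  have h1 := ConcreteCategory.congr_hom (P.p.naturality x.op) b'
  have h2 := ConcreteCategory.congr_hom (q.naturality x.op) (𝟙 Z)
  change P.p.app W (x ≫ b') = _ at h1
  change q.app W (x ≫ 𝟙 Z) = _ at h2
  rw [Category.comp_id] at h2
  change P.p.app W (x ≫ b') = q.app W x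
  rw [h1, h2]
  change F.map x.op (P.p.app (op Z) b) = F.map x.op (q.app (op Z) (𝟙 Z))
  rw [hb]

lemma exists_factor {Z : C} (b : Z ⟶ P.Y) (hb : preadditiveYoneda.map b ≫ P.p = 0) :
    ∃ a : Z ⟶ P.X, a ≫ P.f = b := by
  have h := (ShortComplex.ab_exact_iff _).1 (P.exact.map ((evaluation _ _).obj (op Z))) b (by
    have := ConcreteCategory.congr_hom (NatTrans.congr_app hb (op Z)) (𝟙 Z)
    change P.p.app (op Z) (𝟙 Z ≫ b) = 0 at this
    rw [Category.id_comp] at this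
    exact this)
  exact h

/-- The cokernel of `Hom(-, f)` has `f` as a presenting morphism. -/
def ofCokernel {X Y : C} (f : X ⟶ Y) : Presentation (cokernel (preadditiveYoneda.map f)) where
  X := X
  Y := Y
  f := f
  p := cokernel.π _
  w := cokernel.condition _
  exact := ShortComplex.exact_cokernel _
  epi := inferInstance

/-- A representable functor is presented by `0 : Y ⟶ Y`. -/
def ofRepresentable (Y : C) : Presentation (preadditiveYoneda.obj Y) where
  X := Y
  Y := Y
  f := 0
  p := 𝟙 _
  w := by simp
  exact := (ShortComplex.exact_iff_mono _ (by simp)).2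
    (inferInstance : Mono (𝟙 (preadditiveYoneda.obj Y)))
  epi := inferInstance

end Presentation

lemma isFinPres_cokernel {X Y : C} (f : X ⟶ Y) :
    isFinPres C (cokernel (preadditiveYoneda.map f)) := by
  refine ⟨⟨fun {U V a b} => ?_⟩, ⟨Presentation.ofCokernel f⟩⟩
  have hs : Function.Surjective ((cokernel.π (preadditiveYoneda.map f)).app U) :=
    (AddCommGrpCat.epi_iff_surjective _).1 inferInstance
  ext x
  obtain ⟨y, rfl⟩ := hs x
  have h (c : U ⟶ V) := ConcreteCategory.congr_hom
    ((cokernel.π (preadditiveYoneda.map f)).naturality c) y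
  simp only [ConcreteCategory.comp_apply] at h
  change _ = (cokernel (preadditiveYoneda.map f)).map a _ +
    (cokernel (preadditiveYoneda.map f)).map b _
  rw [← h, ← h, ← h, ← map_add, Functor.map_add]
  rfl

variable (C) in
/-- The Yoneda functor `C ⥤ mod C`. -/
def yonedaMod : C ⥤ FPMod C :=
  FPMod.lift preadditiveYoneda (fun Y => ⟨inferInstance, ⟨Presentation.ofRepresentable Y⟩⟩)

end Basic

section Extension

variable {C : Type u} [Category.{v} C] [Preadditive C]
  {D : Type u'} [Category.{v'} D] [Preadditive D]

/-- A morphism `b` between the targets of the chosen presenting morphisms *covers* `η : F ⟶ F'`. -/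
def Covers {F F' : FPMod C} (η : F ⟶ F') (b : F.pres.Y ⟶ F'.pres.Y) : Prop :=
  preadditiveYoneda.map b ≫ F'.pres.p = F.pres.p ≫ (FPMod.ι C).map η

lemma exists_covers {F F' : FPMod C} (η : F ⟶ F') : ∃ b, Covers η b :=
  F'.pres.exists_lift _

lemma Covers.id (F : FPMod C) : Covers (𝟙 F) (𝟙 _) := by
  simp [Covers]

lemma Covers.comp {F F' F'' : FPMod C} {η : F ⟶ F'} {η' : F' ⟶ F''} {b b'}
    (h : Covers η b) (h' : Covers η' b') : Covers (η ≫ η') (b ≫ b') := by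
  unfold Covers at *
  rw [Functor.map_comp, Category.assoc, h', reassoc_of% h, Functor.map_comp]

variable (G : C ⥤ D) [HasCokernels D]

lemma Covers.condition {F F' : FPMod C} {η : F ⟶ F'} {b} (h : Covers η b) :
    G.map F.pres.f ≫ G.map b ≫ cokernel.π (G.map F'.pres.f) = 0 := by
  obtain ⟨a, ha⟩ := F'.pres.exists_factor (F.pres.f ≫ b) (by
    rw [Functor.map_comp, Category.assoc, h, reassoc_of% F.pres.w, zero_comp])
  rw [← Category.assoc, ← G.map_comp, ← ha, G.map_comp, Category.assoc, cokernel.condition,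
    comp_zero]

variable [G.Additive]

lemma Covers.unique {F F' : FPMod C} {η : F ⟶ F'} {b b'} (h : Covers η b) (h' : Covers η b') :
    G.map b ≫ cokernel.π (G.map F'.pres.f) = G.map b' ≫ cokernel.π (G.map F'.pres.f) := by
  obtain ⟨a, ha⟩ := F'.pres.exists_factor (b - b') (by
    rw [Functor.map_sub, Preadditive.sub_comp, h, h', sub_self])
  rw [← sub_eq_zero, ← Preadditive.sub_comp, ← G.map_sub, ← ha, G.map_comp, Category.assoc,
    cokernel.condition, comp_zero]

/-- The map `Coker G(f) ⟶ Coker G(f')` induced by `η : Coker Hom(-, f) ⟶ Coker Hom(-, f')`. -/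
def extendMap {F F' : FPMod C} (η : F ⟶ F') :
    cokernel (G.map F.pres.f) ⟶ cokernel (G.map F'.pres.f) :=
  cokernel.desc _ (G.map (exists_covers η).choose ≫ cokernel.π _)
    ((exists_covers η).choose_spec.condition G)

lemma π_extendMap {F F' : FPMod C} {η : F ⟶ F'} {b} (h : Covers η b) :
    cokernel.π (G.map F.pres.f) ≫ extendMap G η = G.map b ≫ cokernel.π _ := by
  rw [extendMap, cokernel.π_desc]
  exact (exists_covers η).choose_spec.unique G h

/-- The right exact functor `mod C ⥤ D` extending an additive functor `G : C ⥤ D` to a category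
with cokernels: it sends `Coker Hom(-, f)` to `Coker G(f)`. -/
def extend : FPMod C ⥤ D where
  obj F := cokernel (G.map F.pres.f)
  map η := extendMap G η
  map_id F := by
    rw [← cancel_epi (cokernel.π _), π_extendMap G (Covers.id F)]
    simp
  map_comp {F F' F''} η η' := by
    obtain ⟨b, hb⟩ := exists_covers η
    obtain ⟨b', hb'⟩ := exists_covers η'
    rw [← cancel_epi (cokernel.π _), π_extendMap G (hb.comp hb'), ← Category.assoc,
      π_extendMap G hb, Category.assoc, π_extendMap G hb', G.map_comp, Category.assoc]

/-- The cokernel projection `G(Y) ⟶ Coker G(f)`, where `f : X ⟶ Y` presents `F`. -/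
def extendπ (F : FPMod C) : G.obj F.pres.Y ⟶ (extend G).obj F := cokernel.π (G.map F.pres.f)

instance (F : FPMod C) : Epi (extendπ G F) :=
  inferInstanceAs (Epi (cokernel.π (G.map F.pres.f)))

/-- The universal property of `Coker G(f)`. -/
def extendDesc {F : FPMod C} {T : D} (x : G.obj F.pres.Y ⟶ T) (hx : G.map F.pres.f ≫ x = 0) :
    (extend G).obj F ⟶ T := cokernel.desc _ x hx

lemma extendπ_desc {F : FPMod C} {T : D} (x : G.obj F.pres.Y ⟶ T)
    (hx : G.map F.pres.f ≫ x = 0) : extendπ G F ≫ extendDesc G x hx = x :=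
  cokernel.π_desc _ _ _

lemma map_f_extendπ (F : FPMod C) : G.map F.pres.f ≫ extendπ G F = 0 :=
  cokernel.condition _

lemma extendπ_map {F F' : FPMod C} {η : F ⟶ F'} {b} (h : Covers η b) :
    extendπ G F ≫ (extend G).map η = G.map b ≫ extendπ G F' :=
  π_extendMap G h

lemma Covers.extendπ_eq {F F' : FPMod C} {η : F ⟶ F'} {b b'} (h : Covers η b)
    (h' : Covers η b') : G.map b ≫ extendπ G F' = G.map b' ≫ extendπ G F' :=
  h.unique G h'

/-- The presentation map of a representable functor, as a morphism of `C`. -/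
def repHom (Y : C) : ((yonedaMod C).obj Y).pres.Y ⟶ Y :=
  preadditiveYoneda.preimage ((yonedaMod C).obj Y).pres.p

lemma map_repHom (Y : C) :
    preadditiveYoneda.map (repHom Y) = ((yonedaMod C).obj Y).pres.p :=
  preadditiveYoneda.map_preimage _

/-- The value of `extend G` at a representable functor. -/
def extendYonedaIso (Y : C) : (extend G).obj ((yonedaMod C).obj Y) ≅ G.obj Y where
  hom := extendDesc G (G.map (repHom Y)) (by
    rw [← G.map_comp, ← G.map_zero]
    congr 1
    apply preadditiveYoneda.map_injective
    rw [Functor.map_comp, map_repHom, Functor.map_zero]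
    exact ((yonedaMod C).obj Y).pres.w)
  inv := G.map (((yonedaMod C).obj Y).pres.exists_lift (𝟙 (preadditiveYoneda.obj Y))).choose ≫
    extendπ G _
  hom_inv_id := by
    have h := (((yonedaMod C).obj Y).pres.exists_lift (𝟙 (preadditiveYoneda.obj Y))).choose_spec
    generalize Exists.choose _ = t at h ⊢
    have h1 : Covers (𝟙 ((yonedaMod C).obj Y)) (repHom Y ≫ t) := by
      unfold Covers
      rw [Functor.map_comp, Category.assoc, h, map_repHom, CategoryTheory.Functor.map_id]
      rfl
    rw [← cancel_epi (extendπ G _), ← Category.assoc, extendπ_desc, ← Category.assoc,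
      ← G.map_comp, h1.extendπ_eq G (Covers.id _), G.map_id, Category.id_comp, Category.comp_id]
  inv_hom_id := by
    have h := (((yonedaMod C).obj Y).pres.exists_lift (𝟙 (preadditiveYoneda.obj Y))).choose_spec
    generalize Exists.choose _ = t at h ⊢
    rw [Category.assoc, extendπ_desc, ← G.map_comp, ← G.map_id]
    congr 1
    apply preadditiveYoneda.map_injective
    rw [Functor.map_comp, map_repHom, CategoryTheory.Functor.map_id]
    exact h

/-- `extend G` extends `G` along the Yoneda functor. -/
def yonedaModCompExtend : yonedaMod C ⋙ extend G ≅ G :=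
  NatIso.ofComponents (extendYonedaIso G) (fun {Y Y'} g => by
    obtain ⟨b, hb⟩ := exists_covers ((yonedaMod C).map g)
    dsimp only [extendYonedaIso, Functor.comp_obj, Functor.comp_map]
    rw [← cancel_epi (extendπ G _), ← Category.assoc, extendπ_map G hb, Category.assoc,
      extendπ_desc, ← Category.assoc, extendπ_desc, ← G.map_comp, ← G.map_comp]
    congr 1
    apply preadditiveYoneda.map_injective
    rw [Functor.map_comp, Functor.map_comp, map_repHom, map_repHom]
    exact hb)

end Extension

section Effaceable

variable {A : Type u} [Category.{v} A] [Abelian A]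

lemma Presentation.exists_desc {F : Aᵒᵖ ⥤ AddCommGrpCat.{v}} (P : Presentation F)
    {T : Aᵒᵖ ⥤ AddCommGrpCat.{v}} (x : preadditiveYoneda.obj P.Y ⟶ T)
    (hx : preadditiveYoneda.map P.f ≫ x = 0) : ∃ q : F ⟶ T, P.p ≫ q = x :=
  have := P.epi
  ⟨P.exact.desc x hx, P.exact.g_desc x hx⟩

lemma exists_hom_yonedaMod (F : FPMod A) (X : A) (θ : (extend (𝟭 A)).obj F ⟶ X) :
    ∃ q : F ⟶ (yonedaMod A).obj X,
      F.pres.p ≫ (FPMod.ι A).map q = preadditiveYoneda.map (extendπ (𝟭 A) F ≫ θ) := by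
  obtain ⟨q, hq⟩ := F.pres.exists_desc (preadditiveYoneda.map (extendπ (𝟭 A) F ≫ θ)) (by
    rw [← Functor.map_comp, ← Category.assoc]
    erw [map_f_extendπ (𝟭 A) F]
    rw [zero_comp, Functor.map_zero])
  obtain ⟨q', rfl⟩ := (FPMod.ι A).map_surjective (Y := (yonedaMod A).obj X) q
  exact ⟨q', hq⟩

/-- The bijection `Hom(Coker f, X) ≃ Hom(F, Hom(-, X))` for `F = Coker Hom(-, f)`. -/
def extendIdHomEquiv (F : FPMod A) (X : A) :
    ((extend (𝟭 A)).obj F ⟶ X) ≃ (F ⟶ (yonedaMod A).obj X) :=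
  Equiv.ofBijective (fun θ => (exists_hom_yonedaMod F X θ).choose) (by
    constructor
    · intro θ θ' h
      have h1 := (exists_hom_yonedaMod F X θ).choose_spec
      have h2 := (exists_hom_yonedaMod F X θ').choose_spec
      dsimp only at h
      rw [h, h2] at h1
      exact ((cancel_epi (extendπ (𝟭 A) F)).1 (preadditiveYoneda.map_injective h1)).symm
    · intro q
      let x : F.pres.Y ⟶ X := preadditiveYoneda.preimage (F.pres.p ≫ (FPMod.ι A).map q)
      have hx : preadditiveYoneda.map x = F.pres.p ≫ (FPMod.ι A).map q :=
        preadditiveYoneda.map_preimage _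
      refine ⟨extendDesc (𝟭 A) x ?_, ?_⟩
      · apply preadditiveYoneda.map_injective
        change preadditiveYoneda.map (F.pres.f ≫ x) = _
        rw [Functor.map_comp, hx, Functor.map_zero]
        exact (Category.assoc _ _ _).symm.trans ((congrArg (· ≫ _) F.pres.w).trans zero_comp)
      · have h1 := (exists_hom_yonedaMod F X (extendDesc (𝟭 A) x ?_)).choose_spec.trans
          (congrArg preadditiveYoneda.map (extendπ_desc (𝟭 A) x _))
        have := F.pres.epi
        apply (FPMod.ι A).map_injective
        rw [← cancel_epi F.pres.p]
        exact h1.trans hx)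

lemma p_extendIdHomEquiv (F : FPMod A) (X : A) (θ : (extend (𝟭 A)).obj F ⟶ X) :
    F.pres.p ≫ (FPMod.ι A).map (extendIdHomEquiv F X θ) =
      preadditiveYoneda.map (extendπ (𝟭 A) F ≫ θ) :=
  (exists_hom_yonedaMod F X θ).choose_spec

variable (A) in
/-- The left adjoint of the Yoneda functor `A ⥤ mod A` of an abelian category is the right exact
functor `mod A ⥤ A` extending the identity. -/
def extendIdAdjunction : extend (𝟭 A) ⊣ yonedaMod A :=
  Adjunction.mkOfHomEquiv
    { homEquiv := extendIdHomEquiv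
      homEquiv_naturality_left_symm := fun {F' F X} η q => by
        obtain ⟨θ, rfl⟩ := (extendIdHomEquiv F X).surjective q
        rw [Equiv.symm_apply_apply, Equiv.symm_apply_eq]
        apply (FPMod.ι A).map_injective
        have := F'.pres.epi
        obtain ⟨b, hb⟩ := exists_covers η
        rw [← cancel_epi F'.pres.p, p_extendIdHomEquiv, ← Category.assoc (extendπ _ _),
          extendπ_map _ hb, Functor.map_comp (FPMod.ι A), ← Category.assoc, ← hb,
          Category.assoc, p_extendIdHomEquiv, Category.assoc]
        exact (preadditiveYoneda.map_comp b _).symm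
      homEquiv_naturality_right := fun {F X X'} θ g => by
        apply (FPMod.ι A).map_injective
        have := F.pres.epi
        rw [← cancel_epi F.pres.p, p_extendIdHomEquiv, Functor.map_comp (FPMod.ι A),
          ← Category.assoc, ← Category.assoc, p_extendIdHomEquiv]
        exact preadditiveYoneda.map_comp (extendπ (𝟭 A) F ≫ θ) g }

variable (A) in
/-- `eff A`: the effaceable functors, i.e. the objects of `mod A` which are sent to zero by the
left adjoint of the Yoneda functor `A ⥤ mod A`, see `extendIdAdjunction`. -/
def eff : ObjectProperty (FPMod A) := fun F => IsZero ((extend (𝟭 A)).obj F)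

variable (P : ObjectProperty A)

/-- The functor `i^* : mod C ⥤ mod A` extending the inclusion `i : C ⥤ A` of the full subcategory
`C` of the objects satisfying `P`; it sends `Coker Hom(-, f)` to `Coker Hom(-, i(f))`. -/
def inclMod : FPMod P.FullSubcategory ⥤ FPMod A :=
  FPMod.lift (extend (P.ι ⋙ preadditiveYoneda))
    (fun F => isFinPres_cokernel (P.ι.map F.pres.f))

/-- `eff(A, C) = mod C ∩ eff A`, where `mod C` is viewed as a subcategory of `mod A`
through `i^*`. -/
def effRel : ObjectProperty (FPMod P.FullSubcategory) := (eff A).inverseImage (inclMod P)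

/-- The full subcategory of the objects satisfying `P` generates `A`: every object `X` of `A`
admits an epimorphism `Y ⟶ X` with `Y` satisfying `P`. -/
def Generates : Prop := ∀ X : A, ∃ (Y : A) (g : Y ⟶ X), P Y ∧ Epi g

end Effaceable

end CoherentFunctor

end

/-! Write `E` for `extend P.ι`. If `E` is a localization, it is essentially surjective, and `E F` is
by construction a quotient of an object of `C`; so `C` generates.

Conversely, `effRel_iff` identifies `eff(A, C)` with the kernel of `E`, so it is enough that `E` is
exact and is the quotient functor by its kernel. When `C` generates, `E F` behaves like the
sheafification of `F`, with epimorphisms as coverings: every morphism into `E F` comes locally from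
an element `Hom(-, c) ⟶ F` (`Generates.exists_extendElt`), and an element that dies in `E F` is
locally zero (`Generates.exists_comp_eq_zero`). Since representables are projective in `mod C`, a
chase with elements gives exactness. The local lifting property and essential surjectivity are then
the input to `isLocalization_isoModSerre_of_exact`, a criterion for exact functors between abelian
categories. -/

namespace CoherentFunctor

/-! ### Exact functors that are Serre quotients by their kernel -/

section Localization

variable {B : Type u} [Category.{v} B] [Abelian B] {D : Type u'} [Category.{v'} D] [Abelian D]
  (E : B ⥤ D) [PreservesFiniteLimits E] [PreservesFiniteColimits E]
  {S : ObjectProperty B} [S.IsSerreClass]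

/-- The image of a morphism killed by an exact functor is killed by this functor. -/
lemma isZero_obj_image_of_map_eq_zero {X Y : B} (f : X ⟶ Y) (hf : E.map f = 0) :
    IsZero (E.obj (Abelian.image f)) := by
  have h : E.map (Abelian.factorThruImage f) ≫ E.map (Abelian.image.ι f) = 0 := by
    rw [← E.map_comp, Abelian.image.fac, hf]
  have h' : E.map (Abelian.factorThruImage f) = 0 :=
    (cancel_mono (E.map (Abelian.image.ι f))).1 (by rw [h, zero_comp])
  exact IsZero.of_epi_eq_zero _ h'

/-- If an exact functor `E` sends the two components of `Z ⟶ F ⨯ F'` to `E(x)` and `E(x) ≫ θ`, with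
`E(x)` an epimorphism, then `θ` is represented by a fraction whose denominator has kernel and
cokernel killed by `E`. -/
lemma exists_fraction_of_epi_map (hS : ∀ X, IsZero (E.obj X) → S X) {F F' Z : B}
    (θ : E.obj F ⟶ E.obj F') (x : Z ⟶ F) (x' : Z ⟶ F') (hx : Epi (E.map x))
    (h : E.map x ≫ θ = E.map x') :
    ∃ (G : B) (s : G ⟶ F) (φ : G ⟶ F'), S.isoModSerre s ∧ E.map s ≫ θ = E.map φ := by
  -- The image of `z` is a correspondence from `F` to `F'` that `E` turns into the graph of `θ`; its
  -- two projections form the fraction.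
  let z : Z ⟶ F ⊞ F' := biprod.lift x x'
  let e := Abelian.factorThruImage z
  let s := Abelian.image.ι z ≫ biprod.fst
  let φ := Abelian.image.ι z ≫ biprod.snd
  have hs : e ≫ s = x := by simp [e, s, z]
  have hφ : e ≫ φ = x' := by simp [e, φ, z]
  have hsθ : E.map s ≫ θ = E.map φ := by
    rw [← cancel_epi (E.map e), ← Category.assoc, ← E.map_comp, ← E.map_comp, hφ, hs, h]
  have hepi : Epi (E.map s) := by
    rw [← hs, E.map_comp] at hx
    exact epi_of_epi (E.map e) _
  refine ⟨_, s, φ, ⟨hS _ ?_, hS _ ?_⟩, hsθ⟩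
  -- The kernel of the first projection embeds in `F'` by the second. `E` keeps this a monomorphism
  -- but also sends it to zero, as `E(φ)` factors through `E(s)`.
  · have : Mono (kernel.ι s ≫ φ) := by
      refine Preadditive.mono_of_cancel_zero _ fun {T} t ht => ?_
      rw [← cancel_mono (kernel.ι s), ← cancel_mono (Abelian.image.ι z)]
      refine biprod.hom_ext _ _ ?_ ?_
      · simp only [Category.assoc, zero_comp]
        exact (t ≫= kernel.condition s).trans comp_zero
      · simpa [φ] using ht
    refine IsZero.of_mono_eq_zero (E.map (kernel.ι s ≫ φ)) ?_
    rw [E.map_comp, ← hsθ, ← Category.assoc, ← E.map_comp, kernel.condition, E.map_zero, zero_comp]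
  · refine IsZero.of_epi_eq_zero (E.map (cokernel.π s)) ?_
    rw [← cancel_epi (E.map s), ← E.map_comp, cokernel.condition, E.map_zero, comp_zero]

/-- An essentially surjective exact functor `E` is the quotient functor by its kernel if each
morphism between objects in its image lifts after precomposition with an epimorphism in its
image. -/
theorem isLocalization_isoModSerre_of_exact [E.EssSurj] (hS : ∀ X, S X ↔ IsZero (E.obj X))
    (hE : ∀ ⦃F F' : B⦄ (θ : E.obj F ⟶ E.obj F'), ∃ (Z : B) (x : Z ⟶ F) (x' : Z ⟶ F'),
      Epi (E.map x) ∧ E.map x ≫ θ = E.map x') :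
    E.IsLocalization S.isoModSerre := by
  have hinv : S.isoModSerre.IsInvertedBy E :=
    (S.isoModSerre_isInvertedBy_iff E).2 fun X hX => (hS X).1 hX
  let Q := S.isoModSerre.Q
  let Φ := Localization.Construction.lift E hinv
  have fac : Q ⋙ Φ = E := Localization.Construction.fac E hinv
  have hΦ {X Y : B} (f : X ⟶ Y) : Φ.map (Q.map f) = E.map f :=
    (Functor.congr_hom fac f).trans ((Category.id_comp _).trans (Category.comp_id _))
  have : E.Additive := Functor.additive_of_preserves_binary_products E
  have : (Q ⋙ Φ).Additive := by rwa [fac]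
  have : Φ.Additive := (Localization.functor_additive_iff Q S.isoModSerre Φ).2 inferInstance
  have hobj (X : S.isoModSerre.Localization) : ∃ F, X = Q.obj F :=
    ⟨_, ((Localization.Construction.objEquiv S.isoModSerre).apply_symm_apply X).symm⟩
  have : Φ.EssSurj :=
    ⟨fun X => ⟨Q.obj (E.objPreimage X), ⟨E.objObjPreimageIso X⟩⟩⟩
  have : Φ.Full := ⟨fun {X Y} θ => by
    obtain ⟨F, rfl⟩ := hobj X
    obtain ⟨F', rfl⟩ := hobj Y
    obtain ⟨Z, x, x', hx, h⟩ := hE (F := F) (F' := F') θ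
    obtain ⟨G, s, φ, hs, h⟩ := exists_fraction_of_epi_map (F := F) (F' := F') E
      (fun X => (hS X).2) θ x x' hx h
    have : IsIso (Q.map s) := Localization.inverts Q S.isoModSerre s hs
    have : IsIso (Φ.map (Q.map s)) := inferInstance
    refine ⟨inv (Q.map s) ≫ Q.map φ, ?_⟩
    rw [← cancel_epi (Φ.map (Q.map s)), ← Φ.map_comp, IsIso.hom_inv_id_assoc]
    rw [hΦ, hΦ]
    exact h.symm⟩
  have : Φ.Faithful := ⟨fun {X Y} f g hfg => by
    obtain ⟨F, rfl⟩ := hobj X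
    obtain ⟨F', rfl⟩ := hobj Y
    rw [← sub_eq_zero, ← Φ.map_sub] at hfg
    rw [← sub_eq_zero]
    generalize f - g = k at hfg
    -- Only the numerator of the fraction matters: it dies in the quotient once its image lies in
    -- `S`, that is, once `E` kills that image.
    obtain ⟨ψ, rfl⟩ := Localization.exists_rightFraction Q S.isoModSerre k
    have := Localization.inverts Q S.isoModSerre ψ.s ψ.hs
    rw [← cancel_epi (Q.map ψ.s), MorphismProperty.RightFraction.map_s_comp_map, comp_zero,
      ObjectProperty.SerreClassLocalization.map_eq_zero_iff Q S]
    refine (hS _).2 (isZero_obj_image_of_map_eq_zero E _ ?_)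
    rw [← hΦ, ← MorphismProperty.RightFraction.map_s_comp_map ψ Q
      (Localization.inverts Q S.isoModSerre), Φ.map_comp, hfg]
    exact comp_zero⟩
  exact { inverts := hinv, isEquivalence := { } }

end Localization
-- Representables in `mod C`: projectivity and elements
section Basic

variable {C : Type u} [Category.{v} C] [Preadditive C]

/-- The inclusion of `mod C` in the functor category is additive for any additive structure on
`mod C`. -/
instance [inst : Preadditive (FPMod C)] [HasBinaryBiproducts (FPMod C)] :
    (FPMod.ι C).Additive := by
  -- Binary biproducts determine the addition of morphisms, so the given structure is the pointwise
  -- one.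
  have : Subsingleton (Preadditive (FPMod C)) := inferInstance
  have h : inst = inferInstanceAs (Preadditive (isFinPres C).FullSubcategory) :=
    Subsingleton.elim _ _
  subst h
  exact inferInstanceAs (isFinPres C).ι.Additive

instance [Preadditive (FPMod C)] [HasBinaryBiproducts (FPMod C)] : (yonedaMod C).Additive where
  map_add {X Y f g} := by
    apply (FPMod.ι C).map_injective
    rw [(FPMod.ι C).map_add]
    exact preadditiveYoneda.map_add

/-- The epimorphism `Hom(-, Y) ⟶ F` of the chosen presentation of `F`, as a morphism of `mod C`. -/
noncomputable def presHom (F : FPMod C) : (yonedaMod C).obj F.pres.Y ⟶ F :=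
  (FPMod.ι C).preimage F.pres.p

lemma ι_map_presHom (F : FPMod C) : (FPMod.ι C).map (presHom F) = F.pres.p :=
  (FPMod.ι C).map_preimage _

instance (F : FPMod C) : Epi (presHom F) :=
  (FPMod.ι C).epi_of_epi_map (by rw [ι_map_presHom]; exact F.pres.epi)

lemma exists_yonedaMod_map_presHom {c : C} {F : FPMod C} (x : (yonedaMod C).obj c ⟶ F) :
    ∃ b : c ⟶ F.pres.Y, (yonedaMod C).map b ≫ presHom F = x := by
  obtain ⟨b, hb⟩ := F.pres.exists_lift ((FPMod.ι C).map x)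
  refine ⟨b, (FPMod.ι C).map_injective ?_⟩
  rw [Functor.map_comp, ι_map_presHom]
  exact hb

lemma covers_iff {F F' : FPMod C} (η : F ⟶ F') (b : F.pres.Y ⟶ F'.pres.Y) :
    Covers η b ↔ (yonedaMod C).map b ≫ presHom F' = presHom F ≫ η := by
  rw [← (FPMod.ι C).map_injective.eq_iff, Functor.map_comp, Functor.map_comp, ι_map_presHom,
    ι_map_presHom]
  rfl

section

variable [Preadditive (FPMod C)] [HasBinaryBiproducts (FPMod C)]

lemma yonedaMod_map_f_presHom (F : FPMod C) : (yonedaMod C).map F.pres.f ≫ presHom F = 0 := by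
  apply (FPMod.ι C).map_injective
  rw [Functor.map_comp, ι_map_presHom, Functor.map_zero]
  exact F.pres.w

lemma exists_presHom_comp {F T : FPMod C} (x : (yonedaMod C).obj F.pres.Y ⟶ T)
    (hx : (yonedaMod C).map F.pres.f ≫ x = 0) : ∃ r : F ⟶ T, presHom F ≫ r = x := by
  have := F.pres.epi
  have hx' : preadditiveYoneda.map F.pres.f ≫ (FPMod.ι C).map x = 0 := by
    simpa using! congrArg (FPMod.ι C).map hx
  refine ⟨(FPMod.ι C).preimage (F.pres.exact.desc ((FPMod.ι C).map x) hx'), ?_⟩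
  apply (FPMod.ι C).map_injective
  rw [Functor.map_comp, ι_map_presHom, Functor.map_preimage]
  exact F.pres.exact.g_desc _ hx'

/-- Epimorphisms of `mod C` are surjective on objects of `C`. -/
lemma exists_lift_presHom_of_epi [HasBinaryBiproducts C] {F F' : FPMod C} (η : F ⟶ F') [Epi η] :
    ∃ w : (yonedaMod C).obj F'.pres.Y ⟶ F, w ≫ η = presHom F' := by
  obtain ⟨b, hb⟩ := exists_covers η
  rw [covers_iff] at hb
  -- `Coker Hom(-, d)` is the objectwise cokernel of `η` and is finitely presented, so it can be
  -- tested against the epimorphism `η` inside `mod C`.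
  let d : F'.pres.X ⊞ F.pres.Y ⟶ F'.pres.Y := biprod.desc F'.pres.f b
  let Q : FPMod C := ⟨_, isFinPres_cokernel d⟩
  let q : (yonedaMod C).obj F'.pres.Y ⟶ Q :=
    (FPMod.ι C).preimage (cokernel.π (preadditiveYoneda.map d))
  have hq : (FPMod.ι C).map q = cokernel.π (preadditiveYoneda.map d) :=
    (FPMod.ι C).map_preimage _
  have hdq : (yonedaMod C).map d ≫ q = 0 := by
    apply (FPMod.ι C).map_injective
    rw [Functor.map_comp, hq, Functor.map_zero]
    exact cokernel.condition _
  obtain ⟨r, hr⟩ := exists_presHom_comp q (by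
    rw [show F'.pres.f = biprod.inl ≫ d by simp [d], Functor.map_comp, Category.assoc, hdq,
      comp_zero])
  have hr0 : r = 0 := by
    rw [← cancel_epi η, ← cancel_epi (presHom F), ← Category.assoc, ← hb, Category.assoc, hr,
      show b = biprod.inr ≫ d by simp [d], Functor.map_comp, Category.assoc, hdq]
    simp
  -- The projection onto this cokernel vanishes, so the identity factors through `d`. The second
  -- component of the section `a` gives the lift; the first dies in `F'`.
  obtain ⟨a, ha⟩ := (Presentation.ofCokernel d).exists_factor (𝟙 _) (by
    change _ ≫ cokernel.π (preadditiveYoneda.map d) = 0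
    rw [← hq, ← hr, hr0, comp_zero, Functor.map_zero]
    exact comp_zero)
  replace ha : (show F'.pres.Y ⟶ F'.pres.X ⊞ F.pres.Y from a) ≫ d = 𝟙 F'.pres.Y := ha
  generalize (show F'.pres.Y ⟶ F'.pres.X ⊞ F.pres.Y from a) = a at ha
  refine ⟨(yonedaMod C).map (a ≫ biprod.snd) ≫ presHom F, ?_⟩
  rw [Category.assoc, ← hb, ← Category.assoc, ← Functor.map_comp]
  have h : (a ≫ biprod.snd) ≫ b = 𝟙 _ - (a ≫ biprod.fst) ≫ F'.pres.f := by
    rw [eq_sub_iff_add_eq, ← ha, Category.assoc, Category.assoc, ← Preadditive.comp_add]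
    congr 1
    rw [add_comm]
    simp [d, biprod.desc_eq]
  rw [h, Functor.map_sub, Preadditive.sub_comp, Functor.map_comp, Category.assoc,
    yonedaMod_map_f_presHom]
  simp

lemma projective_yonedaMod_obj [HasBinaryBiproducts C] (c : C) :
    Projective ((yonedaMod C).obj c) where
  factors {F' F} x η _ := by
    obtain ⟨b, rfl⟩ := exists_yonedaMod_map_presHom x
    obtain ⟨w, hw⟩ := exists_lift_presHom_of_epi η
    exact ⟨(yonedaMod C).map b ≫ w, by rw [Category.assoc, hw]⟩

end

variable {D : Type u'} [Category.{v'} D] [Preadditive D] [HasCokernels D] (G : C ⥤ D) [G.Additive]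

instance [Preadditive (FPMod C)] [HasBinaryBiproducts (FPMod C)] : (extend G).Additive where
  map_add {F F' η η'} := by
    obtain ⟨b, hb⟩ := exists_covers η
    obtain ⟨b', hb'⟩ := exists_covers η'
    have h : Covers (η + η') (b + b') := by
      rw [covers_iff] at hb hb' ⊢
      rw [Functor.map_add, Preadditive.add_comp, hb, hb', Preadditive.comp_add]
    rw [← cancel_epi (extendπ G F), extendπ_map G h, Preadditive.comp_add, extendπ_map G hb,
      extendπ_map G hb', G.map_add, Preadditive.add_comp]

/-- The morphism `G(c) ⟶ extend G F` corresponding to an element `Hom(-, c) ⟶ F` of `F(c)`. -/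
noncomputable def extendElt {c : C} {F : FPMod C} (x : (yonedaMod C).obj c ⟶ F) :
    G.obj c ⟶ (extend G).obj F :=
  (yonedaModCompExtend G).inv.app c ≫ (extend G).map x

lemma extendElt_comp {c : C} {F F' : FPMod C} (x : (yonedaMod C).obj c ⟶ F) (η : F ⟶ F') :
    extendElt G (x ≫ η) = extendElt G x ≫ (extend G).map η := by
  simp [extendElt]

lemma extendElt_map_comp {c c' : C} {F : FPMod C} (a : c' ⟶ c) (x : (yonedaMod C).obj c ⟶ F) :
    extendElt G ((yonedaMod C).map a ≫ x) = G.map a ≫ extendElt G x := by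
  have := (yonedaModCompExtend G).inv.naturality a
  dsimp at this
  simp only [extendElt, Functor.map_comp]
  rw [reassoc_of% this]

lemma extendElt_presHom (F : FPMod C) : extendElt G (presHom F) = extendπ G F := by
  have hc : Covers (presHom F) (repHom F.pres.Y) := by
    unfold Covers
    rw [map_repHom, ι_map_presHom]
    rfl
  have h1 : extendπ G _ ≫ (yonedaModCompExtend G).hom.app F.pres.Y = G.map (repHom F.pres.Y) :=
    extendπ_desc G _ _
  rw [extendElt, ← cancel_epi ((yonedaModCompExtend G).hom.app F.pres.Y), Iso.hom_inv_id_app_assoc]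
  rw [← cancel_epi (extendπ G ((yonedaMod C).obj F.pres.Y)), reassoc_of% h1]
  exact extendπ_map G hc

end Basic

/-! ### The extension of the inclusion of a generating subcategory -/

section Relative

lemma Generates.exists_epi {A : Type u} [Category.{v} A] {P : ObjectProperty A}
    (hP : Generates P) (X : A) : ∃ (c : P.FullSubcategory) (a : P.ι.obj c ⟶ X), Epi a := by
  obtain ⟨Y, g, hY, hg⟩ := hP X
  exact ⟨⟨Y, hY⟩, g, hg⟩

variable {A : Type u} [Category.{v} A] [Abelian A]

/-- Effaceability of a functor is read off from an arbitrary presentation. -/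
lemma eff_iff {F : FPMod A} (p : Presentation ((FPMod.ι A).obj F)) :
    eff A F ↔ Epi p.f := by
  have := p.epi
  rw [Preadditive.epi_iff_cancel_zero]
  constructor
  · intro hF X u hu
    obtain ⟨q, hq⟩ := p.exists_desc (T := preadditiveYoneda.obj X) (preadditiveYoneda.map u) (by
      rw [← Functor.map_comp, hu, Functor.map_zero])
    obtain ⟨q', rfl⟩ := (FPMod.ι A).map_surjective (Y := (yonedaMod A).obj X) q
    obtain ⟨q₀, h₀⟩ := p.exists_desc (T := preadditiveYoneda.obj X) (preadditiveYoneda.map 0) (by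
      rw [← Functor.map_comp, comp_zero, Functor.map_zero])
    obtain ⟨q₀', rfl⟩ := (FPMod.ι A).map_surjective (Y := (yonedaMod A).obj X) q₀
    -- By adjunction, an effaceable functor has only one morphism to each representable.
    obtain rfl : q' = q₀' := (extendIdHomEquiv F X).symm.injective (hF.eq_of_src _ _)
    exact preadditiveYoneda.map_injective (hq.symm.trans h₀)
  · intro hf
    have huniq {X : A} (θ : F ⟶ (yonedaMod A).obj X) : p.p ≫ (FPMod.ι A).map θ = 0 := by
      obtain ⟨u, hu⟩ := preadditiveYoneda.map_surjective (X := p.Y) (Y := X)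
        (p.p ≫ (FPMod.ι A).map θ)
      rw [hf X u, Functor.map_zero] at hu
      · exact hu.symm
      · apply preadditiveYoneda.map_injective
        rw [Functor.map_comp, hu, Functor.map_zero]
        exact (Category.assoc _ _ _).symm.trans ((p.w =≫ _).trans zero_comp)
    rw [eff, IsZero.iff_id_eq_zero]
    apply (extendIdHomEquiv F _).injective
    apply (FPMod.ι A).map_injective
    rw [← cancel_epi p.p, huniq, huniq]

variable (P : ObjectProperty A)

/-- `eff(A, C)` is the kernel of the functor `mod C ⥤ A` extending the inclusion. -/
lemma effRel_iff (F : FPMod P.FullSubcategory) :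
    effRel P F ↔ IsZero ((extend P.ι).obj F) := by
  have h : effRel P F ↔ Epi (P.ι.map F.pres.f) :=
    eff_iff (F := (inclMod P).obj F) (Presentation.ofCokernel (P.ι.map F.pres.f))
  rw [h]
  exact ⟨fun _ => isZero_cokernel_of_epi _, fun h => Preadditive.epi_of_isZero_cokernel _ h⟩

variable {P} (hP : Generates P)

include hP in
/-- Morphisms to `extend P.ι F` come locally from elements of `F`. -/
lemma Generates.exists_extendElt {F : FPMod P.FullSubcategory} {T : A}
    (t : T ⟶ (extend P.ι).obj F) :
    ∃ (c : P.FullSubcategory) (a : P.ι.obj c ⟶ T) (_ : Epi a)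
      (x : (yonedaMod P.FullSubcategory).obj c ⟶ F), a ≫ t = extendElt P.ι x := by
  obtain ⟨T', a, _, b, hb⟩ := surjective_up_to_refinements_of_epi (extendπ P.ι F) t
  obtain ⟨c, a', _⟩ := hP.exists_epi T'
  obtain ⟨b', hb'⟩ := P.ι.map_surjective (a' ≫ b)
  refine ⟨c, a' ≫ a, inferInstance, (yonedaMod _).map b' ≫ presHom F, ?_⟩
  rw [extendElt_map_comp, extendElt_presHom, hb', Category.assoc, hb, Category.assoc]

include hP in
lemma Generates.exists_epi_map_comp_eq {F F' : FPMod P.FullSubcategory}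
    (θ : (extend P.ι).obj F ⟶ (extend P.ι).obj F') :
    ∃ (Z : FPMod P.FullSubcategory) (x : Z ⟶ F) (x' : Z ⟶ F'),
      Epi ((extend P.ι).map x) ∧ (extend P.ι).map x ≫ θ = (extend P.ι).map x' := by
  obtain ⟨c, a, _, x', h⟩ := hP.exists_extendElt (extendπ P.ι F ≫ θ)
  obtain ⟨b, rfl⟩ := P.ι.map_surjective a
  have hx : extendElt P.ι ((yonedaMod _).map b ≫ presHom F) = P.ι.map b ≫ extendπ P.ι F := by
    rw [extendElt_map_comp, extendElt_presHom]
  refine ⟨_, (yonedaMod _).map b ≫ presHom F, x', ?_, ?_⟩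
  · have : Epi (extendElt P.ι ((yonedaMod _).map b ≫ presHom F)) := by
      rw [hx]
      infer_instance
    unfold extendElt at this
    exact epi_of_epi ((yonedaModCompExtend P.ι).inv.app c) _
  · rw [← cancel_epi ((yonedaModCompExtend P.ι).inv.app c), ← Category.assoc]
    exact (hx =≫ θ).trans ((Category.assoc _ _ _).trans h)

variable [Abelian (FPMod P.FullSubcategory)]

include hP in
/-- An element of `F` which vanishes in `extend P.ι F` is locally zero. -/
lemma Generates.exists_comp_eq_zero {F : FPMod P.FullSubcategory} {c : P.FullSubcategory}
    (x : (yonedaMod P.FullSubcategory).obj c ⟶ F) (hx : extendElt P.ι x = 0) :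
    ∃ (c' : P.FullSubcategory) (a : c' ⟶ c), Epi (P.ι.map a) ∧ (yonedaMod _).map a ≫ x = 0 := by
  obtain ⟨b, rfl⟩ := exists_yonedaMod_map_presHom x
  rw [extendElt_map_comp, extendElt_presHom] at hx
  -- A morphism to `F.pres.Y` that vanishes in the cokernel of the presenting morphism lifts locally
  -- to `F.pres.X`; a cover by an object of `C` and fullness bring the lift into `C`.
  obtain ⟨T, a, _, k, hk⟩ := (ShortComplex.exact_cokernel
    (P.ι.map F.pres.f)).exact_up_to_refinements (P.ι.map b) hx
  obtain ⟨c', a', _⟩ := hP.exists_epi T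
  obtain ⟨k', hk'⟩ := P.ι.map_surjective (a' ≫ k)
  obtain ⟨l, hl⟩ := P.ι.map_surjective (a' ≫ a)
  refine ⟨c', l, by rw [hl]; infer_instance, ?_⟩
  have h : l ≫ b = k' ≫ F.pres.f := by
    apply P.ι.map_injective
    rw [Functor.map_comp, Functor.map_comp, hl, hk', Category.assoc, Category.assoc]
    exact a' ≫= hk
  rw [← Category.assoc, ← Functor.map_comp, h, Functor.map_comp, Category.assoc,
    yonedaMod_map_f_presHom, comp_zero]

variable [HasFiniteBiproducts P.FullSubcategory]

-- A cycle in `E S.X₂` is locally an element `x` of `S.X₂`. After a further covering `x ≫ S.g` is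
-- zero, and projectivity of the representable lifts `x` through `S.f`.
include hP in
lemma Generates.exact_map_extend (S : ShortComplex (FPMod P.FullSubcategory)) (hS : S.Exact) :
    (S.map (extend P.ι)).Exact := by
  rw [ShortComplex.exact_iff_exact_up_to_refinements]
  intro T (t : T ⟶ (extend P.ι).obj S.X₂) (ht : t ≫ (extend P.ι).map S.g = 0)
  have : HasBinaryBiproducts P.FullSubcategory := hasBinaryBiproducts_of_finite_biproducts _
  obtain ⟨c, a, _, x, hx⟩ := hP.exists_extendElt t
  obtain ⟨c', a', _, h⟩ := hP.exists_comp_eq_zero (x ≫ S.g) (by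
    rw [extendElt_comp, ← hx, Category.assoc, ht, comp_zero])
  rw [← Category.assoc] at h
  have : Projective ((yonedaMod P.FullSubcategory).obj c') :=
    projective_yonedaMod_obj c'
  let w := hS.liftFromProjective _ h
  have hw : (P.ι.map a' ≫ a) ≫ t = extendElt P.ι w ≫ (extend P.ι).map S.f := by
    rw [Category.assoc, hx, ← extendElt_map_comp, ← extendElt_comp, hS.liftFromProjective_comp]
  exact ⟨_, P.ι.map a' ≫ a, epi_comp _ _, extendElt P.ι w, hw⟩

include hP in
lemma Generates.exact_extend :
    PreservesFiniteLimits (extend P.ι) ∧ PreservesFiniteColimits (extend P.ι) :=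
  ((extend P.ι).exact_tfae.out 1 3).1 hP.exact_map_extend

-- Covering `X`, then the kernel of the covering, presents `X` as the cokernel of a morphism `f` of
-- `C`. As `E` preserves cokernels and restricts to the inclusion on representables, it sends the
-- cokernel of `Hom(-, f)` to `X`.
include hP in
lemma Generates.essSurj_extend : (extend P.ι).EssSurj where
  mem_essImage X := by
    obtain ⟨_, _⟩ := hP.exact_extend
    obtain ⟨c, a, _⟩ := hP.exists_epi X
    obtain ⟨c', a', _⟩ := hP.exists_epi (kernel a)
    obtain ⟨f, hf⟩ := P.ι.map_surjective (a' ≫ kernel.ι a)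
    have w : P.ι.map f ≫ a = 0 := by rw [hf, Category.assoc, kernel.condition, comp_zero]
    have hex : (ShortComplex.mk _ _ w).Exact := by
      rw [ShortComplex.exact_iff_exact_up_to_refinements]
      intro T t ht
      obtain ⟨T', b, _, s, hs⟩ := surjective_up_to_refinements_of_epi a' (kernel.lift a t ht)
      refine ⟨T', b, inferInstance, s, ?_⟩
      have := hs =≫ kernel.ι a
      simp only [Category.assoc, kernel.lift_ι] at this
      exact this.trans (s ≫= hf.symm)
    have : Epi (ShortComplex.mk _ _ w).g := ‹Epi a›
    let e₁ : (extend P.ι).obj (cokernel ((yonedaMod _).map f)) ≅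
        cokernel ((extend P.ι).map ((yonedaMod _).map f)) :=
      PreservesCokernel.iso (extend P.ι) ((yonedaMod _).map f)
    let e₂ : cokernel ((extend P.ι).map ((yonedaMod _).map f)) ≅ cokernel (P.ι.map f) :=
      cokernel.mapIso _ _ ((yonedaModCompExtend P.ι).app c') ((yonedaModCompExtend P.ι).app c)
        ((yonedaModCompExtend P.ι).hom.naturality f)
    let e₃ : cokernel (P.ι.map f) ≅ X :=
      (cokernelIsCokernel (P.ι.map f)).coconePointUniqueUpToIso hex.gIsCokernel
    exact ⟨_, ⟨e₁ ≪≫ e₂ ≪≫ e₃⟩⟩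

end Relative

end CoherentFunctor

theorem proposition3p4 {A : Type u} [Category.{v} A] [Abelian A]
    (P : ObjectProperty A) [HasFiniteBiproducts P.FullSubcategory]
    [Abelian (CoherentFunctor.FPMod P.FullSubcategory)] :
    CoherentFunctor.Generates P ↔
      PreservesFiniteLimits (CoherentFunctor.extend P.ι) ∧
      PreservesFiniteColimits (CoherentFunctor.extend P.ι) ∧
      ∃ _ : (CoherentFunctor.effRel P).IsSerreClass,
        (CoherentFunctor.extend P.ι).IsLocalization (CoherentFunctor.effRel P).isoModSerre := by
  constructor
  · intro hP
    obtain ⟨hl, hr⟩ := hP.exact_extend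
    have := hP.essSurj_extend
    have heq : CoherentFunctor.effRel P =
        ObjectProperty.inverseImage (fun X => IsZero X) (CoherentFunctor.extend P.ι) := by
      ext F
      exact CoherentFunctor.effRel_iff P F
    have hS : (CoherentFunctor.effRel P).IsSerreClass := by
      rw [heq]
      infer_instance
    exact ⟨hl, hr, hS, CoherentFunctor.isLocalization_isoModSerre_of_exact _
      (CoherentFunctor.effRel_iff P) fun _ _ => hP.exists_epi_map_comp_eq⟩
  · rintro ⟨_, _, _, _⟩ X
    have := Localization.essSurj (CoherentFunctor.extend P.ι)
      (CoherentFunctor.effRel P).isoModSerre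
    let F := (CoherentFunctor.extend P.ι).objPreimage X
    exact ⟨_, CoherentFunctor.extendπ P.ι F ≫
      ((CoherentFunctor.extend P.ι).objObjPreimageIso X).hom, F.pres.Y.property, epi_comp _ _⟩
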